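/- For a number field $K$ with ring of integers $\mathcal{O}_K$ and ideal class group $Cl_K$, the Pólya group $Po(K)$ is the subgroup of $Cl_K$ generated by the classes of the ideals $\Pi_q(K)$, $q \in \mathbb{N}$, where $\Pi_q(K)$ is the product of all nonzero prime ideals of $\mathcal{O}_K$ of norm $q$ (and $\Pi_q(K) = \mathcal{O}_K$ if there are none). **Theorem.** Let $k \geq 1$ be an integer and let $M > 0$ be a real number. Then there exists an integer $d > 0$ such that, for every $j = 1, \ldots, k$, the field $K_j := \mathbb{Q}(\sqrt{jd})$ is a (real) quadratic field with $|Po(K_j)| > M$. Likewise, there exists an integer $d < 0$ such that, for every $j = 1, \ldots, k$, the field $K_j := \mathbb{Q}(\sqrt{jd})$ is an (imaginary) quadratic field with $|Po(K_j)| > M$. -/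

import Mathlib

open NumberField IsDedekindDomain

/-- The field `ℚ(√m)`, as a subfield of `ℂ`, generated over `ℚ` by the (principal) square root
of the integer `m`. -/
noncomputable def quadField (m : ℤ) : IntermediateField ℚ ℂ :=
  IntermediateField.adjoin ℚ {(m : ℂ) ^ (1 / 2 : ℂ)}

theorem cpow_half_sq (m : ℤ) : ((m : ℂ) ^ (1 / 2 : ℂ)) ^ 2 = (m : ℂ) := by
  simp

theorem isIntegral_cpow_half (m : ℤ) : IsIntegral ℚ ((m : ℂ) ^ (1 / 2 : ℂ)) := by
  refine IsIntegral.of_pow (n := 2) (by norm_num) ?_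
  rw [cpow_half_sq]
  exact_mod_cast isIntegral_algebraMap (R := ℚ) (A := ℂ) (x := (m : ℚ))

noncomputable instance instNumberFieldQuadField (m : ℤ) : NumberField (quadField m) where
  to_charZero := inferInstance
  to_finiteDimensional := IntermediateField.adjoin.finiteDimensional (isIntegral_cpow_half m)

/-- The ideal `Π_q(K)`: the product of all nonzero prime ideals of `𝓞 K` of norm `q`.
It is the unit ideal if there is no such prime. -/
noncomputable def polyaIdeal (K : Type*) [Field K] [NumberField K] (q : ℕ) : Ideal (𝓞 K) :=
  ∏ᶠ (v : HeightOneSpectrum (𝓞 K)) (_ : Ideal.absNorm v.asIdeal = q), v.asIdeal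

/-- The product that defines `polyaIdeal` is over a finite set. -/
theorem finite_primes_of_absNorm (K : Type*) [Field K] [NumberField K] (q : ℕ) :
    {v : HeightOneSpectrum (𝓞 K) | Ideal.absNorm v.asIdeal = q}.Finite := by
  refine Set.Finite.of_finite_image (f := HeightOneSpectrum.asIdeal) ?_ ?_
  · refine (Ideal.finite_setOfPred_absNorm_eq (S := 𝓞 K) q).subset ?_
    rintro _ ⟨v, hv, rfl⟩
    exact hv
  · intro v _ w _ h
    exact HeightOneSpectrum.ext h

theorem polyaIdeal_ne_zero (K : Type*) [Field K] [NumberField K] (q : ℕ) :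
    polyaIdeal K q ≠ 0 := by
  unfold polyaIdeal
  refine finprod_induction (fun I : Ideal (𝓞 K) => I ≠ 0) one_ne_zero
    (fun _ _ => mul_ne_zero) fun v => ?_
  exact finprod_induction (fun I : Ideal (𝓞 K) => I ≠ 0) one_ne_zero
    (fun _ _ => mul_ne_zero) fun _ => v.ne_bot

/-- The Pólya group `Po(K)`: the subgroup of the ideal class group of `K` generated by the
classes of the ideals `Π_q(K)`. -/
noncomputable def polyaGroup (K : Type*) [Field K] [NumberField K] :
    Subgroup (ClassGroup (𝓞 K)) :=
  Subgroup.closure (Set.range fun q : ℕ =>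
    ClassGroup.mk0 ⟨polyaIdeal K q, mem_nonZeroDivisors_of_ne_zero (polyaIdeal_ne_zero K q)⟩)

/-! Take `d` to be plus or minus a product of distinct primes exceeding `k`. For `j ≤ k` each of
them divides `m = j * d` exactly once, hence ramifies in `ℚ(√m)` and `Π_p ^ 2 = (p)`
(`polyaIdeal_sq`). Keep one prime `r` aside and let `Q` be the set of the others. If subsets `S`,
`T` of `Q` give the same class `∏ Π_p`, squaring shows that `∏ S` and `∏ T` agree up to a unit and
squares of `K`. Units modulo squares take at most four values, so five subsets with one class would
make `∏ S * ∏ S'` a square in `K` for some `S ≠ S'`. This is impossible by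
`quadField.not_isSquare_intCast`. Hence `2 ^ #Q ≤ 4 * |Po(K)|`, and `Q` can be as large as desired.
-/

theorem not_isSquare_of_dvd_of_not_sq_dvd {p N : ℤ} (hp : Prime p) (h : p ∣ N)
    (h2 : ¬ p ^ 2 ∣ N) : ¬ IsSquare N := by
  rintro ⟨r, rfl⟩
  have hr : p ∣ r := (hp.dvd_or_dvd h).elim id id
  exact h2 (by rw [sq]; exact mul_dvd_mul hr hr)

/-! ### Units modulo squares -/

/-- Units of a number field are determined modulo squares by `rank + 1` parities. -/
theorem exists_parity_units (K : Type*) [Field K] [NumberField K] :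
    ∃ f : (𝓞 K)ˣ → ZMod 2 × (Fin (Units.rank K) → ZMod 2),
      ∀ u v, f u = f v → IsSquare (u * v) := by
  obtain ⟨g, hg⟩ := IsCyclic.exists_generator (α := Units.torsion K)
  have key : ∀ u : (𝓞 K)ˣ, ∃ c : ℤ × (Fin (Units.rank K) → ℤ),
      u = (g : (𝓞 K)ˣ) ^ c.1 * ∏ i, Units.fundSystem K i ^ c.2 i := by
    intro u
    obtain ⟨⟨z, e⟩, h, -⟩ := Units.exist_unique_eq_mul_prod K u
    obtain ⟨a, ha⟩ := Subgroup.mem_zpowers_iff.mp (hg z)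
    refine ⟨(a, e), ?_⟩
    rw [h, ← ha]
    simp
  -- The exponent of `g` is not unique; any choice serves, since only its parity is used.
  choose c hc using key
  refine ⟨fun u => (((c u).1 : ZMod 2), fun i => ((c u).2 i : ZMod 2)), fun u v h => ?_⟩
  obtain ⟨h1, h2⟩ := Prod.ext_iff.mp h
  have ev : ∀ a b : ℤ, (a : ZMod 2) = (b : ZMod 2) → Even (a + b) := by
    intro a b hab
    rw [ZMod.intCast_eq_intCast_iff_dvd_sub] at hab
    rw [Int.even_add]
    exact (Int.even_sub.mp (even_iff_two_dvd.mpr hab)).symm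
  have huv : u * v = (g : (𝓞 K)ˣ) ^ ((c u).1 + (c v).1) *
      ∏ i, Units.fundSystem K i ^ ((c u).2 i + (c v).2 i) := by
    conv_lhs => rw [hc u, hc v]
    simp only [zpow_add, Finset.prod_mul_distrib]
    exact mul_mul_mul_comm _ _ _ _
  rw [huv]
  refine ((ev _ _ h1).isSquare_zpow _).mul ?_
  exact Finset.prod_induction _ IsSquare (fun _ _ => IsSquare.mul) IsSquare.one
    fun i _ => (ev _ _ (congrFun h2 i)).isSquare_zpow _

theorem rank_units_lt_finrank (K : Type*) [Field K] [NumberField K] :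
    Units.rank K < Module.finrank ℚ K := by
  have h1 := InfinitePlace.card_add_two_mul_card_eq_rank K
  have h2 := InfinitePlace.card_eq_nrRealPlaces_add_nrComplexPlaces (K := K)
  have h3 : 0 < Module.finrank ℚ K := Module.finrank_pos
  rw [Units.rank]
  omega

/-! ### Ramified primes -/

/-- A prime dividing `θ ^ 2 ∈ ℤ` exactly once is the square of `Π_p`, in a field of degree two. -/
theorem polyaIdeal_sq (K : Type*) [Field K] [NumberField K] (hK : Module.finrank ℚ K = 2)
    (θ : 𝓞 K) (m : ℤ) (hθ : θ ^ 2 = (m : 𝓞 K)) (p : ℕ) (hp : p.Prime)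
    (hpm : (p : ℤ) ∣ m) (hpm2 : ¬ (p : ℤ) ^ 2 ∣ m) :
    polyaIdeal K p ^ 2 = Ideal.span {(p : 𝓞 K)} := by
  obtain ⟨c, rfl⟩ := hpm
  have hcop : IsCoprime (p : ℤ) c := by
    refine (Prime.coprime_iff_not_dvd (Nat.prime_iff_prime_int.mp hp)).mpr fun h => hpm2 ?_
    rw [sq]
    exact mul_dvd_mul_left _ h
  obtain ⟨a, b, hab⟩ := hcop
  have hab' : (a : 𝓞 K) * p + b * c = 1 := by exact_mod_cast congrArg (Int.cast : ℤ → 𝓞 K) hab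
  push_cast at hθ
  set P : Ideal (𝓞 K) := Ideal.span {(p : 𝓞 K), θ} with hP
  have hP2 : P ^ 2 = Ideal.span {(p : 𝓞 K)} := by
    rw [sq, hP, Ideal.span_pair_mul_span_pair]
    apply le_antisymm
    · rw [Ideal.span_le]
      rintro x hx
      simp only [Set.mem_insert_iff, Set.mem_singleton_iff] at hx
      rw [SetLike.mem_coe, Ideal.mem_span_singleton]
      rcases hx with rfl | rfl | rfl | rfl
      · exact dvd_mul_right _ _
      · exact dvd_mul_right _ _
      · exact dvd_mul_left _ _
      · rw [← sq, hθ]; exact dvd_mul_right _ _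
    · rw [Ideal.span_singleton_le_iff_mem]
      -- This is `p` times the Bézout relation, as `θ ^ 2 = p * c`.
      have : a * (p * p) + b * (θ * θ) = (p : 𝓞 K) := by
        rw [← sq θ, hθ]
        linear_combination (p : 𝓞 K) * hab'
      have hmem : a * (p * p) + b * (θ * θ) ∈
          Ideal.span {(p : 𝓞 K) * p, p * θ, θ * p, θ * θ} :=
        Ideal.add_mem _ (Ideal.mul_mem_left _ _ (Ideal.subset_span (by simp)))
          (Ideal.mul_mem_left _ _ (Ideal.subset_span (by simp)))
      rwa [this] at hmem
  have hnorm : Ideal.absNorm P = p := by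
    have h := congrArg Ideal.absNorm hP2
    rw [map_pow, Ideal.absNorm_span_natCast, RingOfIntegers.rank, hK] at h
    exact Nat.pow_left_injective two_ne_zero h
  have hprime : P.IsPrime := by
    refine Ideal.isPrime_of_irreducible_absNorm ?_
    rw [hnorm]
    exact hp
  have hbot : P ≠ ⊥ := by
    intro h
    rw [h, Ideal.absNorm_bot] at hnorm
    exact hp.ne_zero hnorm.symm
  have huniq : ∀ v : HeightOneSpectrum (𝓞 K),
      Ideal.absNorm v.asIdeal = p ↔ v = ⟨P, hprime, hbot⟩ := by
    intro v
    constructor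
    · intro hv
      have hmem : (p : 𝓞 K) ∈ v.asIdeal := hv ▸ Ideal.absNorm_mem v.asIdeal
      have hle : P ≤ v.asIdeal := by
        refine v.isPrime.le_of_pow_le (n := 2) ?_
        rwa [hP2, Ideal.span_singleton_le_iff_mem]
      have := hprime.isMaximal hbot
      exact HeightOneSpectrum.ext (this.eq_of_le v.isPrime.ne_top hle).symm
    · rintro rfl
      exact hnorm
  have : polyaIdeal K p = P := by
    unfold polyaIdeal
    simp only [huniq]
    exact finprod_mem_singleton (f := fun v : HeightOneSpectrum (𝓞 K) => v.asIdeal)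
  rw [this, hP2]

/-! ### Arithmetic of `ℚ(√m)` -/

section quadField

variable {m : ℤ}

/-- The generator `√m` of `quadField m`. -/
noncomputable def quadField.gen (m : ℤ) : quadField m :=
  IntermediateField.AdjoinSimple.gen ℚ ((m : ℂ) ^ (1 / 2 : ℂ))

theorem quadField.gen_sq (m : ℤ) : quadField.gen m ^ 2 = (m : quadField m) := by
  apply Subtype.ext
  change ((m : ℂ) ^ (1 / 2 : ℂ)) ^ 2 = ((m : quadField m) : ℂ)
  rw [cpow_half_sq]
  rfl

theorem quadField.exists_eq_add_mul_gen (z : quadField m) :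
    ∃ a b : ℚ, z = (a : quadField m) + b * quadField.gen m := by
  have hs : ((m : ℂ) ^ (1 / 2 : ℂ)) * ((m : ℂ) ^ (1 / 2 : ℂ)) = ((m : ℚ) : ℂ) := by
    rw [← sq, cpow_half_sq]; simp
  have key : ∀ w ∈ Algebra.adjoin ℚ {(m : ℂ) ^ (1 / 2 : ℂ)},
      ∃ a b : ℚ, w = (a : ℂ) + b * (m : ℂ) ^ (1 / 2 : ℂ) := by
    intro w hw
    induction hw using Algebra.adjoin_induction with
    | mem x hx => exact ⟨0, 1, by simpa using hx⟩
    | algebraMap r => exact ⟨r, 0, by simp⟩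
    | add x y _ _ hx hy =>
      obtain ⟨a, b, rfl⟩ := hx
      obtain ⟨a', b', rfl⟩ := hy
      exact ⟨a + a', b + b', by push_cast; ring⟩
    | mul x y _ _ hx hy =>
      obtain ⟨a, b, rfl⟩ := hx
      obtain ⟨a', b', rfl⟩ := hy
      refine ⟨a * a' + b * b' * m, a * b' + a' * b, ?_⟩
      push_cast at hs ⊢
      linear_combination (b * b' : ℂ) * hs
  have hz : (z : ℂ) ∈ Algebra.adjoin ℚ {(m : ℂ) ^ (1 / 2 : ℂ)} := by
    rw [← IntermediateField.adjoin_simple_toSubalgebra_of_isAlgebraic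
      (isIntegral_cpow_half m).isAlgebraic]
    exact z.2
  obtain ⟨a, b, h⟩ := key _ hz
  refine ⟨a, b, Subtype.ext ?_⟩
  rw [h]
  rfl

/-- If `a = (x + y√m) ^ 2`, the cross term `2xy√m` is rational: either `y = 0` and `a` is a square,
or `x = 0` and `a * m` is one, or `√m` is rational. -/
theorem quadField.not_isSquare_intCast {a : ℤ} (hm : ¬ IsSquare m) (ha : ¬ IsSquare a)
    (ham : ¬ IsSquare (a * m)) : ¬ IsSquare (a : quadField m) := by
  rintro ⟨z, hz⟩
  obtain ⟨x, y, rfl⟩ := quadField.exists_eq_add_mul_gen z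
  have hg := quadField.gen_sq m
  by_cases hy : y = 0
  · refine ha (Rat.isSquare_intCast_iff.mp ⟨x, ?_⟩)
    subst hy
    simp only [Rat.cast_zero, zero_mul, add_zero] at hz
    exact_mod_cast hz
  by_cases hx : x = 0
  · refine ham (Rat.isSquare_intCast_iff.mp ⟨y * m, ?_⟩)
    subst hx
    have : (a : quadField m) = (y ^ 2 * m : ℚ) := by
      push_cast
      rw [hz, ← hg]
      push_cast
      ring
    have h' : (a : ℚ) = y ^ 2 * m := by exact_mod_cast this
    push_cast
    rw [h']
    ring
  · refine hm (Rat.isSquare_intCast_iff.mp ⟨(a - x ^ 2 - y ^ 2 * m) / (2 * x * y), ?_⟩)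
    have hgen : ((2 * x * y : ℚ) : quadField m) * quadField.gen m =
        ((a - x ^ 2 - y ^ 2 * m : ℚ) : quadField m) := by
      push_cast
      rw [hz, ← hg]
      ring
    have h2 : ((m : ℚ) * (2 * x * y) ^ 2) = (a - x ^ 2 - y ^ 2 * m) ^ 2 := by
      have : (((m : ℚ) * (2 * x * y) ^ 2 : ℚ) : quadField m) =
          ((a - x ^ 2 - y ^ 2 * m) ^ 2 : ℚ) := by
        rw [Rat.cast_pow, ← hgen, mul_pow _ (quadField.gen m), hg]
        push_cast
        exact mul_comm _ _
      exact_mod_cast this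
    have hxy : (2 * x * y) ≠ 0 := by simp [hx, hy]
    field_simp
    linear_combination h2

theorem quadField.isQuadraticExtension (hm : ¬ IsSquare m) :
    Algebra.IsQuadraticExtension ℚ (quadField m) where
  finrank_eq_two' := by
    have hmin : minpoly ℚ ((m : ℂ) ^ (1 / 2 : ℂ)) = Polynomial.X ^ 2 - Polynomial.C (m : ℚ) := by
      refine (minpoly.eq_of_irreducible_of_monic ?_ ?_
        (Polynomial.monic_X_pow_sub_C _ two_ne_zero)).symm
      · refine X_pow_sub_C_irreducible_of_prime Nat.prime_two fun b hb => ?_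
        exact hm (Rat.isSquare_intCast_iff.mp ⟨b, by rw [← hb, sq]⟩)
      · simp
    unfold quadField
    rw [IntermediateField.adjoin.finrank (isIntegral_cpow_half m), hmin]
    exact Polynomial.natDegree_X_pow_sub_C

end quadField

/-! ### Counting classes of products of ramified primes -/

/-- The class of `Π_q` as an element of the Pólya group. -/
noncomputable def polyaGroup.mk (K : Type*) [Field K] [NumberField K] (q : ℕ) : polyaGroup K :=
  ⟨ClassGroup.mk0 ⟨polyaIdeal K q, mem_nonZeroDivisors_of_ne_zero (polyaIdeal_ne_zero K q)⟩,
    Subgroup.subset_closure ⟨q, rfl⟩⟩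

theorem polyaGroup.exists_of_prod_mk_eq {K : Type*} [Field K] [NumberField K] {S T : Finset ℕ}
    (hS : ∀ p ∈ S, polyaIdeal K p ^ 2 = Ideal.span {(p : 𝓞 K)})
    (hT : ∀ p ∈ T, polyaIdeal K p ^ 2 = Ideal.span {(p : 𝓞 K)})
    (h : ∏ p ∈ S, polyaGroup.mk K p = ∏ p ∈ T, polyaGroup.mk K p) :
    ∃ u : (𝓞 K)ˣ, ∃ x y : 𝓞 K, x ≠ 0 ∧
      x ^ 2 * ∏ p ∈ S, (p : 𝓞 K) = u * (y ^ 2 * ∏ p ∈ T, (p : 𝓞 K)) := by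
  have h' := congrArg (polyaGroup K).subtype h
  simp only [map_prod] at h'
  change ∏ p ∈ S, ClassGroup.mk0 _ = ∏ p ∈ T, ClassGroup.mk0 _ at h'
  rw [← map_prod, ← map_prod, ClassGroup.mk0_eq_mk0_iff] at h'
  obtain ⟨x, y, hx, -, hxy⟩ := h'
  simp only [SubmonoidClass.coe_finsetProd] at hxy
  have h2 := congrArg (· ^ 2) hxy
  simp only [mul_pow, ← Finset.prod_pow, Ideal.span_singleton_pow] at h2
  rw [Finset.prod_congr rfl hS, Finset.prod_congr rfl hT, Ideal.prod_span_singleton,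
    Ideal.prod_span_singleton, Ideal.span_singleton_mul_span_singleton,
    Ideal.span_singleton_mul_span_singleton, Ideal.span_singleton_eq_span_singleton] at h2
  obtain ⟨u, hu⟩ := h2.symm
  exact ⟨u, x, y, hx, by rw [← hu, mul_comm]⟩

theorem not_isSquare_prod_mul_prod {S T : Finset ℕ} (hS : ∀ p ∈ S, p.Prime)
    (hT : ∀ p ∈ T, p.Prime) (hST : S ≠ T) :
    ¬ IsSquare ((∏ p ∈ S, (p : ℤ)) * ∏ p ∈ T, (p : ℤ)) := by
  have key : ∀ {S T : Finset ℕ}, (∀ p ∈ S, p.Prime) → (∀ p ∈ T, p.Prime) → ¬ S ⊆ T →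
      ¬ IsSquare ((∏ p ∈ S, (p : ℤ)) * ∏ p ∈ T, (p : ℤ)) := by
    intro S T hS hT hST
    obtain ⟨p, hpS, hpT⟩ := Finset.not_subset.mp hST
    have hp := Nat.prime_iff_prime_int.mp (hS p hpS)
    have hnd : ∀ R : Finset ℕ, (∀ q ∈ R, q.Prime) → p ∉ R → ¬ (p : ℤ) ∣ ∏ q ∈ R, (q : ℤ) := by
      intro R hR hpR
      refine hp.not_dvd_finsetProd fun q hq hdvd => hpR ?_
      rwa [(Nat.prime_dvd_prime_iff_eq (hS p hpS) (hR q hq)).mp (Int.natCast_dvd_natCast.mp hdvd)]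
    rw [← Finset.mul_prod_erase S _ hpS, mul_assoc]
    refine not_isSquare_of_dvd_of_not_sq_dvd hp (dvd_mul_right _ _) ?_
    rw [sq, mul_dvd_mul_iff_left hp.ne_zero]
    exact hp.not_dvd_mul (hnd _ (fun q hq => hS q (Finset.mem_of_mem_erase hq)) (by simp))
      (hnd _ hT hpT)
  rcases not_and_or.mp (mt (fun h => Finset.Subset.antisymm h.1 h.2) hST) with h | h
  · exact key hS hT h
  · rw [mul_comm]
    exact key hT hS h

theorem two_pow_card_le_card_polyaGroup {m : ℤ} {r : ℕ} {Q : Finset ℕ} (hrQ : r ∉ Q)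
    (hprime : ∀ p ∈ insert r Q, p.Prime) (hdvd : ∀ p ∈ insert r Q, (p : ℤ) ∣ m)
    (hsq : ∀ p ∈ insert r Q, ¬ (p : ℤ) ^ 2 ∣ m) :
    Algebra.IsQuadraticExtension ℚ (quadField m) ∧
      2 ^ Q.card ≤ 4 * Nat.card (polyaGroup (quadField m)) := by
  classical
  have hr := Finset.mem_insert_self r Q
  have hrp := Nat.prime_iff_prime_int.mp (hprime r hr)
  have hm : ¬ IsSquare m := not_isSquare_of_dvd_of_not_sq_dvd hrp (hdvd r hr) (hsq r hr)
  have hquad := quadField.isQuadraticExtension hm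
  refine ⟨hquad, ?_⟩
  set K := quadField m
  have hfin : Module.finrank ℚ K = 2 := Algebra.IsQuadraticExtension.finrank_eq_two ℚ K
  have hint : IsIntegral ℤ (quadField.gen m) := by
    refine IsIntegral.of_pow (n := 2) two_pos ?_
    rw [quadField.gen_sq]
    exact isIntegral_algebraMap (R := ℤ) (x := m)
  obtain ⟨t, ht⟩ : ∃ t : 𝓞 K, algebraMap (𝓞 K) K t = quadField.gen m :=
    ⟨⟨_, hint⟩, rfl⟩
  have htm : t ^ 2 = (m : 𝓞 K) := FaithfulSMul.algebraMap_injective (𝓞 K) K (by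
    rw [map_pow, map_intCast, ht]
    exact quadField.gen_sq m)
  have hpol : ∀ p ∈ Q, polyaIdeal K p ^ 2 = Ideal.span {(p : 𝓞 K)} := fun p hp =>
    have hp' := Finset.mem_insert_of_mem hp
    polyaIdeal_sq K hfin t m htm p (hprime p hp') (hdvd p hp') (hsq p hp')
  have hQp : ∀ p ∈ Q, p.Prime := fun p hp => hprime p (Finset.mem_insert_of_mem hp)
  have hnsq : ∀ S ⊆ Q, ∀ T ⊆ Q, S ≠ T →
      ¬ IsSquare ((((∏ p ∈ S, (p : ℤ)) * ∏ p ∈ T, (p : ℤ) : ℤ)) : K) := by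
    intro S hS T hT hST
    refine quadField.not_isSquare_intCast hm (not_isSquare_prod_mul_prod
      (fun p hp => hQp p (hS hp)) (fun p hp => hQp p (hT hp)) hST) ?_
    have hnd : ∀ R ⊆ Q, ¬ (r : ℤ) ∣ ∏ q ∈ R, (q : ℤ) := by
      intro R hR
      refine hrp.not_dvd_finsetProd fun q hq hd => hrQ ?_
      rw [(Nat.prime_dvd_prime_iff_eq (hprime r hr) (hQp q (hR hq))).mp
        (Int.natCast_dvd_natCast.mp hd)]
      exact hR hq
    -- Here the reserved prime `r` acts: it divides `m` exactly once and neither product.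
    refine not_isSquare_of_dvd_of_not_sq_dvd hrp (dvd_mul_of_dvd_right (hdvd r hr) _) fun h => ?_
    have hco := (hrp.coprime_iff_not_dvd).mpr (hrp.not_dvd_mul (hnd S hS) (hnd T hT))
    exact hsq r hr (hco.pow_left.dvd_of_dvd_mul_left h)
  obtain ⟨f, hf⟩ := exists_parity_units K
  have hcard : Fintype.card (ZMod 2 × (Fin (Units.rank K) → ZMod 2)) ≤ 4 := by
    have hrank : Units.rank K < 2 := hfin ▸ rank_units_lt_finrank K
    simp only [Fintype.card_prod, ZMod.card, Fintype.card_pi, Finset.prod_const, Finset.card_univ,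
      Fintype.card_fin]
    interval_cases Units.rank K <;> norm_num
  have hfib := Finset.card_le_mul_card_image (f := fun S => ∏ p ∈ S, polyaGroup.mk K p)
    Q.powerset 4 (by
      intro c hc
      obtain ⟨T, hT, rfl⟩ := Finset.mem_image.mp hc
      rw [Finset.mem_powerset] at hT
      have hrel : ∀ S : Finset ℕ, ∃ u : (𝓞 K)ˣ, S ∈ Q.powerset.filter
          (fun S => ∏ p ∈ S, polyaGroup.mk K p = ∏ p ∈ T, polyaGroup.mk K p) →
          ∃ x y : 𝓞 K, x ≠ 0 ∧
            x ^ 2 * ∏ p ∈ S, (p : 𝓞 K) = u * (y ^ 2 * ∏ p ∈ T, (p : 𝓞 K)) := by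
        intro S
        by_cases hS : S ∈ Q.powerset.filter
          (fun S => ∏ p ∈ S, polyaGroup.mk K p = ∏ p ∈ T, polyaGroup.mk K p)
        · have hS' := Finset.mem_filter.mp hS
          obtain ⟨u, h⟩ := polyaGroup.exists_of_prod_mk_eq
            (fun p hp => hpol p (Finset.mem_powerset.mp hS'.1 hp))
            (fun p hp => hpol p (hT hp)) hS'.2
          exact ⟨u, fun _ => h⟩
        -- Outside the fibre the unit is a dummy value.
        · exact ⟨1, fun h => absurd h hS⟩
      choose u hu using hrel
      refine (Finset.card_le_card_of_injOn (t := Finset.univ) (fun S => f (u S))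
        (fun _ _ => Finset.mem_coe.mpr (Finset.mem_univ _)) ?_).trans hcard
      intro S hS S' hS' hSS'
      by_contra hne
      rw [Finset.mem_coe] at hS hS'
      obtain ⟨x, y, hx, hxy⟩ := hu S hS
      obtain ⟨x', y', hx', hxy'⟩ := hu S' hS'
      obtain ⟨w, hw⟩ := hf _ _ hSS'
      refine hnsq S (Finset.mem_powerset.mp (Finset.mem_filter.mp hS).1) S'
        (Finset.mem_powerset.mp (Finset.mem_filter.mp hS').1) hne
        -- The root comes from multiplying the relations for `S` and `S'`, with `u S * u S' = w ^
        -- 2`.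
        ⟨((w : 𝓞 K) : K) * y * y' * (∏ p ∈ T, (p : K)) / (x * x'), ?_⟩
      have hwK : ((u S : 𝓞 K) : K) * (u S' : 𝓞 K) = ((w : 𝓞 K) : K) * (w : 𝓞 K) := by
        exact_mod_cast congrArg (fun v : (𝓞 K)ˣ => ((v : 𝓞 K) : K)) hw
      have e1 := congrArg (algebraMap (𝓞 K) K) hxy
      have e2 := congrArg (algebraMap (𝓞 K) K) hxy'
      simp only [map_mul, map_pow, map_prod, map_natCast] at e1 e2
      have hx0 : (x : K) ≠ 0 := RingOfIntegers.coe_ne_zero_iff.mpr hx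
      have hx0' : (x' : K) ≠ 0 := RingOfIntegers.coe_ne_zero_iff.mpr hx'
      push_cast
      rw [div_mul_div_comm, eq_div_iff (by simp [hx0, hx0'])]
      generalize (∏ p ∈ S, (p : K)) = a at *
      generalize (∏ p ∈ S', (p : K)) = b at *
      generalize (∏ p ∈ T, (p : K)) = c at *
      linear_combination (x' : K) ^ 2 * b * e1 + ((u S : 𝓞 K) : K) * (y ^ 2 * c) * e2 +
        (y : K) ^ 2 * y' ^ 2 * c ^ 2 * hwK)
  rw [Finset.card_powerset] at hfib
  refine hfib.trans (Nat.mul_le_mul_left 4 ?_)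
  have := Fintype.ofFinite (polyaGroup K)
  rw [Nat.card_eq_fintype_card]
  exact Finset.card_le_univ _

/-! ### Choice of `d` -/

theorem exists_finset_primes_gt (k n : ℕ) :
    ∃ Q : Finset ℕ, Q.card = n ∧ ∀ p ∈ Q, p.Prime ∧ k < p := by
  obtain ⟨Q, hQ, hc⟩ := (Nat.infinite_setOfPred_prime.sdiff (Set.finite_Iic k)).exists_subset_card_eq n
  exact ⟨Q, hc, fun p hp => ⟨(hQ hp).1, not_le.mp (hQ hp).2⟩⟩

theorem two_pow_card_le_card_polyaGroup_mul {k r : ℕ} {Q : Finset ℕ} (hrQ : r ∉ Q)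
    (hQ : ∀ p ∈ insert r Q, p.Prime ∧ k < p) {s : ℤ} (hs : IsUnit s) {j : ℕ} (hj : 1 ≤ j)
    (hjk : j ≤ k) :
    Algebra.IsQuadraticExtension ℚ (quadField (j * (s * ∏ p ∈ insert r Q, (p : ℤ)))) ∧
      2 ^ Q.card ≤
        4 * Nat.card (polyaGroup (quadField (j * (s * ∏ p ∈ insert r Q, (p : ℤ))))) := by
  refine two_pow_card_le_card_polyaGroup hrQ (fun p hp => (hQ p hp).1) ?_ ?_
  · exact fun p hp => dvd_mul_of_dvd_right (dvd_mul_of_dvd_right (Finset.dvd_prod_of_mem _ hp) _) _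
  · intro p hp
    have hpp := Nat.prime_iff_prime_int.mp (hQ p hp).1
    rw [← Finset.mul_prod_erase _ _ hp, sq,
      show (j : ℤ) * (s * (p * ∏ q ∈ (insert r Q).erase p, (q : ℤ))) =
        p * (j * (s * ∏ q ∈ (insert r Q).erase p, (q : ℤ))) by ring,
      mul_dvd_mul_iff_left hpp.ne_zero]
    refine hpp.not_dvd_mul (fun h => ?_) (hpp.not_dvd_mul (fun h => hpp.not_isUnit
      (isUnit_of_dvd_unit h hs)) (hpp.not_dvd_finsetProd fun q hq h => ?_))
    · have := Nat.le_of_dvd hj (Int.natCast_dvd_natCast.mp h)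
      have := (hQ p hp).2
      omega
    · have hq' := Finset.mem_erase.mp hq
      exact hq'.1 ((Nat.prime_dvd_prime_iff_eq (hQ p hp).1 (hQ q hq'.2).1).mp
        (Int.natCast_dvd_natCast.mp h)).symm

theorem theorem5p6 (k : ℕ) (hk : 1 ≤ k) (M : ℝ) (hM : 0 < M) :
    (∃ d : ℤ, 0 < d ∧ ∀ j : ℕ, 1 ≤ j → j ≤ k →
      Algebra.IsQuadraticExtension ℚ (quadField (j * d)) ∧
        M < (Nat.card (polyaGroup (quadField (j * d))) : ℝ)) ∧
    (∃ d : ℤ, d < 0 ∧ ∀ j : ℕ, 1 ≤ j → j ≤ k →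
      Algebra.IsQuadraticExtension ℚ (quadField (j * d)) ∧
        M < (Nat.card (polyaGroup (quadField (j * d))) : ℝ)) := by
  obtain ⟨n, hn⟩ := pow_unbounded_of_one_lt (4 * M) (one_lt_two (α := ℝ))
  -- The extra prime is the reserved `r`.
  obtain ⟨R, hcard, hR⟩ := exists_finset_primes_gt k (n + 1)
  obtain ⟨r, Q, hrQ, rfl, hQ⟩ := Finset.card_eq_succ.mp hcard
  have hpos : 0 < ∏ p ∈ insert r Q, (p : ℤ) :=
    Finset.prod_pos fun p hp => Int.natCast_pos.mpr (hR p hp).1.pos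
  have main : ∀ s : ℤ, IsUnit s → ∀ j : ℕ, 1 ≤ j → j ≤ k →
      Algebra.IsQuadraticExtension ℚ (quadField (j * (s * ∏ p ∈ insert r Q, (p : ℤ)))) ∧
        M < (Nat.card (polyaGroup (quadField (j * (s * ∏ p ∈ insert r Q, (p : ℤ))))) : ℝ) := by
    intro s hs j hj hjk
    obtain ⟨h1, h2⟩ := two_pow_card_le_card_polyaGroup_mul hrQ hR hs hj hjk
    refine ⟨h1, ?_⟩
    rw [hQ] at h2
    have h3 := Nat.cast_le (α := ℝ).mpr h2
    push_cast at h3 hn ⊢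
    linarith
  exact ⟨⟨_, by simpa using hpos, main 1 isUnit_one⟩,
    ⟨_, by simpa using hpos, main (-1) isUnit_one.neg⟩⟩
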